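/- Let $\mathcal A$ and $\mathcal B$ be unital $C^*$-algebras, let $T$ be a locally compact Hausdorff space with a Radon measure $\mu$, and let $m\le M$ be real numbers. Let $(x_t)_{t\in T}$ be a bounded norm-continuous field of self-adjoint elements of $\mathcal A$ with spectra in $[m,M]$. Let $(\phi_t)_{t\in T}$ be a unital field of positive linear maps $\phi_t:\mathcal A\to\mathcal B$; that is, $t\mapsto\phi_t(a)$ is continuous for every $a\in\mathcal A$, and $t\mapsto\phi_t(\mathbf 1)$ is (Bochner) integrable with $\int_T\phi_t(\mathbf 1)\,d\mu(t)=\mathbf 1$. Let $f,g:[m,M]\to\mathbf R$ be continuous, let $U,V\subseteq\mathbf R$ satisfy $f([m,M])\subseteq U$ and $g([m,M])\subseteq V$, and let $F:U\times V\to\mathbf R$ be a bounded function that can be applied to operators by replacing numbers with operators. That is, $F(t,s)$ is the value at numbers $t\in U$, $s\in V$ of an expression in two variables formed from real constants and the variables by sums, products, real functions of one variable and pointwise limits of sequences, and this expression also makes sense for all self-adjoint elements $x,y$ of any unital $C^*$-algebra with spectra in $U$ and $V$ respectively: real functions of one variable are applied to self-adjoint elements by the continuous functional calculus, limits are norm limits,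 and the order of the factors in products is part of the expression. Write $F[x,y]$ for the value of this expression at $x,y$. Assume that $F$ is operator monotone in the first variable: $F[x,y]\le F[x',y]$ for all self-adjoint operators $x\le x'$ and $y$ on an infinite dimensional Hilbert space such that the spectra of $x,x'$ are in $U$ and the spectrum of $y$ is in $V$. Then $t\mapsto\phi_t(x_t)$ and $t\mapsto\phi_t(f(x_t))$ are integrable, $\int_T\phi_t(x_t)\,d\mu(t)$ is self-adjoint with spectrum in $[m,M]$, and $\int_T\phi_t(f(x_t))\,d\mu(t)$ and $g\left(\int_T\phi_t(x_t)\,d\mu(t)\right)$ are self-adjoint with spectra in $U$ and $V$ respectively. If $f$ is operator convex on $[m,M]$ (that is, $f$ is continuous and $f(\lambda x+(1-\lambda)y)\le\lambda f(x)+(1-\lambda)f(y)$ for all $\lambda\in[0,1]$ and all self-adjoint operators $x,y$ on an infinite dimensional Hilbert space with spectra in $[m,M]$), then $$F\left[\int_T\phi_t(f(x_t))\,d\mu(t),\ g\left(\int_T\phi_t(x_t)\,d\mu(t)\right)\right]\ \ge\ \inf_{m\le z\le M}F[f(z),g(z)]\,\mathbf 1 .$$ If $f$ is operator concave on $[m,M]$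 (that is, $-f$ is operator convex on $[m,M]$), then $$F\left[\int_T\phi_t(f(x_t))\,d\mu(t),\ g\left(\int_T\phi_t(x_t)\,d\mu(t)\right)\right]\ \le\ \sup_{m\le z\le M}F[f(z),g(z)]\,\mathbf 1 .$$ -/

import Mathlib

open MeasureTheory Filter Topology
open scoped BoundedContinuousFunction

universe u v w

/-- `f` is operator convex on `I`: it is continuous on `I`, and
`f (c x + (1 - c) y) ≤ c f(x) + (1 - c) f(y)` for all self-adjoint operators `x`, `y` with spectra
in `I` on an infinite dimensional Hilbert space and all `c ∈ [0, 1]`. -/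
def OperatorConvexOn (I : Set ℝ) (f : ℝ → ℝ) : Prop :=
  ContinuousOn f I ∧
    ∀ (H : Type u) [NormedAddCommGroup H] [InnerProductSpace ℂ H] [CompleteSpace H],
      ¬ FiniteDimensional ℂ H →
      ∀ x y : H →L[ℂ] H, IsSelfAdjoint x → IsSelfAdjoint y →
        spectrum ℝ x ⊆ I → spectrum ℝ y ⊆ I →
        ∀ c ∈ Set.Icc (0 : ℝ) 1,
          cfc f (c • x + (1 - c) • y) ≤ c • cfc f x + (1 - c) • cfc f y

/-- `f` is operator concave on `I` if `-f` is operator convex on `I`. -/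
def OperatorConcaveOn (I : Set ℝ) (f : ℝ → ℝ) : Prop :=
  OperatorConvexOn.{u} I (fun t => -f t)

/-- A map assigning an element `Φ D x y` to two elements `x`, `y` of a unital C⋆-algebra `D`. -/
abbrev OperatorMap : Type (u + 1) :=
  ∀ (D : Type u) [CStarAlgebra D], D → D → D

/-- The pairs at which a function on `U × V` is evaluated: self-adjoint `x` with spectrum in `U`
and self-adjoint `y` with spectrum in `V`. -/
def AdmissiblePair (U V : Set ℝ) {D : Type u} [CStarAlgebra D] (x y : D) : Prop :=
  IsSelfAdjoint x ∧ IsSelfAdjoint y ∧ spectrum ℝ x ⊆ U ∧ spectrum ℝ y ⊆ V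

/-- `IsOperatorVersion U V F Φ`: the operator map `Φ` arises from the function `F(t, s)` on `U × V`
by replacing numbers with operators. That is, `F(t, s)` and `Φ D x y` are the values, at numbers
and at operators, of one expression in two variables, formed from real constants and the variables
by sums, products (whose order matters for operators), real functions of one variable (applied to
self-adjoint operators by the continuous functional calculus, where this is defined), and limits
(in norm, for operators). -/
inductive IsOperatorVersion (U V : Set ℝ) : (ℝ → ℝ → ℝ) → OperatorMap.{u} → Prop
  | const (r : ℝ) : IsOperatorVersion U V (fun _ _ => r) (fun D _ _ _ => algebraMap ℝ D r)
  | fst : IsOperatorVersion U V (fun t _ => t) (fun _ _ x _ => x)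
  | snd : IsOperatorVersion U V (fun _ s => s) (fun _ _ _ y => y)
  | add (F G : ℝ → ℝ → ℝ) (Φ Ψ : OperatorMap.{u}) :
      IsOperatorVersion U V F Φ → IsOperatorVersion U V G Ψ →
      IsOperatorVersion U V (fun t s => F t s + G t s) (fun D _ x y => Φ D x y + Ψ D x y)
  | mul (F G : ℝ → ℝ → ℝ) (Φ Ψ : OperatorMap.{u}) :
      IsOperatorVersion U V F Φ → IsOperatorVersion U V G Ψ →
      IsOperatorVersion U V (fun t s => F t s * G t s) (fun D _ x y => Φ D x y * Ψ D x y)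
  | comp (h : ℝ → ℝ) (F : ℝ → ℝ → ℝ) (Φ : OperatorMap.{u}) :
      IsOperatorVersion U V F Φ →
      (∀ (D : Type u) [CStarAlgebra D] (x y : D), AdmissiblePair U V x y →
        IsSelfAdjoint (Φ D x y) ∧ ContinuousOn h (spectrum ℝ (Φ D x y))) →
      IsOperatorVersion U V (fun t s => h (F t s)) (fun D _ x y => cfc h (Φ D x y))
  | lim (Fn : ℕ → ℝ → ℝ → ℝ) (Φn : ℕ → OperatorMap.{u}) (F : ℝ → ℝ → ℝ) (Φ : OperatorMap.{u}) :
      (∀ n, IsOperatorVersion U V (Fn n) (Φn n)) →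
      (∀ t ∈ U, ∀ s ∈ V, Tendsto (fun n => Fn n t s) atTop (𝓝 (F t s))) →
      (∀ (D : Type u) [CStarAlgebra D] (x y : D), AdmissiblePair U V x y →
        Tendsto (fun n => Φn n D x y) atTop (𝓝 (Φ D x y))) →
      IsOperatorVersion U V F Φ

/-- `Φ` is operator monotone in the first variable: `x ≤ x'` implies `Φ(x, y) ≤ Φ(x', y)` for
self-adjoint operators on an infinite dimensional Hilbert space, the spectra of `x` and `x'` being
in `U` and that of `y` in `V`. -/
def OperatorMonotoneFst (U V : Set ℝ) (Φ : OperatorMap.{u}) : Prop :=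
  ∀ (H : Type u) [NormedAddCommGroup H] [InnerProductSpace ℂ H] [CompleteSpace H],
    ¬ FiniteDimensional ℂ H →
    ∀ x x' y : H →L[ℂ] H, AdmissiblePair U V x y → AdmissiblePair U V x' y →
      x ≤ x' → Φ (H →L[ℂ] H) x y ≤ Φ (H →L[ℂ] H) x' y

/-- A unital (continuous) field of positive linear maps: `t ↦ φ t a` is continuous for every `a`,
and `t ↦ φ t 1` is integrable with integral `1`. -/
structure IsUnitalField {T : Type w} [TopologicalSpace T] [MeasurableSpace T] (μ : Measure T)
    {A : Type v} [CStarAlgebra A] [PartialOrder A] [StarOrderedRing A]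
    {B : Type u} [CStarAlgebra B] [PartialOrder B] [StarOrderedRing B]
    (φ : T → A →ₚ[ℂ] B) : Prop where
  continuous (a : A) : Continuous fun t => φ t a
  integrable_one : Integrable (fun t => φ t 1) μ
  integral_one : ∫ t, φ t 1 ∂μ = 1

/-!
The theorem follows from Jensen's operator inequality for the field,
`f(∫ φ_t(x_t)) ≤ ∫ φ_t(f(x_t))` (`OperatorConvexOn.cfc_integral_le`). With `z = ∫ φ_t(x_t)`,
monotonicity in the first variable gives `F[∫ φ_t(f(x_t)), g(z)] ≥ F[f(z), g(z)]`, and the right-hand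
side is the functional calculus of `s ↦ F(f(s), g(s))` at `z` (`IsOperatorVersion.apply_cfc`), hence
bounded below by the infimum of that function on `[m, M]`. The concave case applies the same argument
to `-f`.

Convexity and monotonicity are assumed only for operators on infinite dimensional Hilbert spaces.
Both pass to an arbitrary unital C⋆-algebra, since positivity can be tested in representations: GNS
representations of the positive functionals, amplified to infinite multiplicity
(`nonneg_of_forall_representation`). All functions involved commute with representations
(`StarAlgHom.map_cfc_real`, `IsOperatorVersion.map`).

For Jensen's inequality, the field only enters through the unital positive linear map
`Ψ(h) = ∫ φ_t(h(x_t))` on `C([m, M], ℝ)` (`IsUnitalField.integralMap`). Bernstein polynomials replace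
`Ψ` by a finite resolution `∑ eᵢ = 1` into positive elements
(`OperatorConvexOn.map_coordIcc_le`), and the inequality `f(∑ sᵢ eᵢ) ≤ ∑ f(sᵢ) eᵢ`
(`OperatorConvexOn.cfc_sum_smul_le`) comes from the unitary dilation argument of Hansen and Pedersen
(`OperatorConvexOn.cfc_partialIsometry_le`), carried out in matrix algebras over the given
C⋆-algebra, to which operator convexity has been transferred.
-/

/-! ### Positivity in a C⋆-algebra through infinite dimensional representations -/

open scoped ComplexOrder ComplexStarModule in
/-- Positive functionals detect positivity. The self-adjoint case is Hahn–Banach separation from the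
closed cone of nonnegative elements; the general case follows because a real functional `l` that is
nonnegative on the cone extends to the positive functional `a ↦ l (ℜ a) + i l (ℑ a)`. -/
theorem nonneg_of_forall_positiveLinearMap {D : Type u} [CStarAlgebra D] [PartialOrder D]
    [StarOrderedRing D] {d : D} (h : ∀ ω : D →ₚ[ℂ] ℂ, (0 : ℂ) ≤ ω d) : 0 ≤ d := by
  have key : ∀ a : D, IsSelfAdjoint a → ¬ 0 ≤ a → ∃ l : D →ₗ[ℝ] ℝ, (∀ b, 0 ≤ b → 0 ≤ l b) ∧
      l a < 0 := by
    intro a ha hna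
    have hconv : Convex ℝ {b : D | 0 ≤ b} := by
      intro p hp q hq r s hr hs _
      exact add_nonneg (smul_nonneg hr hp) (smul_nonneg hs hq)
    obtain ⟨l, c, hla, hl⟩ := geometric_hahn_banach_point_closed (x := a) hconv
      CStarAlgebra.isClosed_nonneg hna
    have hc : c < 0 := by simpa using hl 0 le_rfl
    refine ⟨l.toLinearMap, fun b hb => ?_, hla.trans hc⟩
    -- a functional bounded below on a cone is nonnegative there
    by_contra! hlb
    have hlb' : l b < 0 := hlb
    have h1 := hl ((c / l b) • b) (smul_nonneg (div_nonneg_of_nonpos hc.le hlb'.le) hb)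
    rw [map_smul, smul_eq_mul, div_mul_cancel₀ _ hlb'.ne] at h1
    exact lt_irrefl _ h1
  have ext : ∀ l : D →ₗ[ℝ] ℝ, (∀ b, 0 ≤ b → 0 ≤ l b) → ∃ ω : D →ₚ[ℂ] ℂ, ∀ a,
      ω a = (l ((realPart a : selfAdjoint D) : D) : ℂ) +
        Complex.I * (l ((imaginaryPart a : selfAdjoint D) : D) : ℂ) := by
    intro l hl
    refine ⟨PositiveLinearMap.mk₀
      { toFun := fun a => (l ((realPart a : selfAdjoint D) : D) : ℂ) +
          Complex.I * (l ((imaginaryPart a : selfAdjoint D) : D) : ℂ)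
        map_add' := fun a b => ?_
        map_smul' := fun c a => ?_ } (fun a ha => ?_), fun a => rfl⟩
    · simp only [map_add, AddSubgroup.coe_add, Complex.ofReal_add]
      ring
    · simp only [realPart_smul, imaginaryPart_smul, AddSubgroup.coe_sub, AddSubgroup.coe_add,
        selfAdjoint.val_smul, map_sub, map_add, map_smul, smul_eq_mul, RingHom.id_apply]
      apply Complex.ext <;> simp
    · have hs : IsSelfAdjoint a := .of_nonneg ha
      simp only [LinearMap.coe_mk, AddHom.coe_mk, hs.coe_realPart, hs.imaginaryPart]
      simpa using hl a ha
  have hpos : ∀ l : D →ₗ[ℝ] ℝ, (∀ b, 0 ≤ b → 0 ≤ l b) →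
      0 ≤ l (realPart d : D) ∧ l (imaginaryPart d : D) = 0 := by
    intro l hl
    obtain ⟨ω, hω⟩ := ext l hl
    have := h ω
    rw [hω, Complex.le_def] at this
    simpa [eq_comm] using this
  have him : (imaginaryPart d : D) = 0 := by
    apply le_antisymm
    · by_contra hn
      obtain ⟨l, hl, hla⟩ := key (-(imaginaryPart d : D)) (imaginaryPart d).2.neg (by simpa using hn)
      rw [map_neg, (hpos l hl).2] at hla
      simp at hla
    · by_contra hn
      obtain ⟨l, hl, hla⟩ := key (imaginaryPart d : D) (imaginaryPart d).2 hn
      exact hla.ne (hpos l hl).2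
  have hre : 0 ≤ (realPart d : D) := by
    by_contra hn
    obtain ⟨l, hl, hla⟩ := key _ (realPart d).2 hn
    exact absurd (hpos l hl).1 hla.not_ge
  rw [← realPart_add_I_smul_imaginaryPart d, him]
  simpa using hre

section Amplification

variable {H : Type u} [NormedAddCommGroup H] [InnerProductSpace ℂ H]

theorem memℓp_comp (T : H →L[ℂ] H) (v : lp (fun _ : ℕ => H) 2) :
    Memℓp (fun i => T (v i)) 2 :=
  ((lp.memℓp v).norm.const_mul ‖T‖).mono fun i => by simpa using T.le_opNorm (v i)

/-- The operator `T ⊕ T ⊕ ⋯` on the direct sum `ℓ²(ℕ, H)` of countably many copies of `H`. -/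
noncomputable def amplify (T : H →L[ℂ] H) :
    lp (fun _ : ℕ => H) 2 →L[ℂ] lp (fun _ : ℕ => H) 2 :=
  LinearMap.mkContinuous
    { toFun := fun v => ⟨fun i => T (v i), memℓp_comp T v⟩
      map_add' := fun v w => by ext i; simp; rfl
      map_smul' := fun c v => by ext i; simp }
    ‖T‖ (fun v => by
      have := lp.norm_mono (p := 2) (x := ⟨fun i => T (v i), memℓp_comp T v⟩)
        (y := (‖T‖ : ℂ) • v) two_ne_zero (fun i => by
          rw [lp.coeFn_smul, Pi.smul_apply, norm_smul]
          simpa using T.le_opNorm (v i))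
      rw [norm_smul] at this
      simpa using this)

@[simp]
theorem amplify_apply (T : H →L[ℂ] H) (v : lp (fun _ : ℕ => H) 2) (i : ℕ) :
    amplify T v i = T (v i) := rfl

variable (H) in
/-- The amplification `T ↦ T ⊕ T ⊕ ⋯` as a unital ⋆-homomorphism. -/
noncomputable def amplifyHom [CompleteSpace H] : (H →L[ℂ] H) →⋆ₐ[ℂ]
    (lp (fun _ : ℕ => H) 2 →L[ℂ] lp (fun _ : ℕ => H) 2) where
  toFun := amplify
  map_one' := by ext; simp
  map_mul' _ _ := by ext; simp
  map_zero' := by ext; simp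
  map_add' _ _ := by ext; simp
  commutes' r := by ext; simp [Algebra.algebraMap_eq_smul_one]
  map_star' T := by
    refine (ContinuousLinearMap.eq_adjoint_iff _ _).mpr fun x y => ?_
    rw [lp.inner_eq_tsum, lp.inner_eq_tsum]
    simp [ContinuousLinearMap.star_eq_adjoint, ContinuousLinearMap.adjoint_inner_left]

theorem not_finiteDimensional_lp [Nontrivial H] :
    ¬ FiniteDimensional ℂ (lp (fun _ : ℕ => H) 2) := by
  intro hfin
  obtain ⟨ξ, hξ⟩ := exists_ne (0 : H)
  have hli : LinearIndependent ℂ fun i : ℕ => lp.single (E := fun _ : ℕ => H) 2 i ξ := by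
    refine linearIndependent_of_ne_zero_of_inner_eq_zero (𝕜 := ℂ) (fun i h0 => hξ ?_)
      fun i j hij => ?_
    · simpa using congrArg (fun v : lp (fun _ : ℕ => H) 2 => v i) h0
    · simp [lp.inner_single_left, Pi.single_eq_of_ne hij]
  exact Set.infinite_univ (Set.finite_univ_iff.2 hli.finite)

end Amplification

open scoped ComplexOrder in
/-- Positivity can be tested in the unital representations on infinite dimensional Hilbert spaces of
the same universe: for a positive functional `ω`, use its GNS representation, amplified to infinite
multiplicity because the GNS space may have finite dimension. -/
theorem nonneg_of_forall_representation {D : Type u} [CStarAlgebra D] [PartialOrder D]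
    [StarOrderedRing D] {d : D}
    (h : ∀ (H : Type u) [NormedAddCommGroup H] [InnerProductSpace ℂ H] [CompleteSpace H],
      ¬ FiniteDimensional ℂ H → ∀ π : D →⋆ₐ[ℂ] (H →L[ℂ] H), 0 ≤ π d) : 0 ≤ d := by
  refine nonneg_of_forall_positiveLinearMap fun ω => ?_
  let ξ : ω.GNS := (ω.toPreGNS 1 : ω.PreGNS)
  have hξ : inner ℂ ξ (ω.gnsStarAlgHom d ξ) = ω d := by
    simp [ξ, UniformSpace.Completion.inner_coe, PositiveLinearMap.preGNS_inner_def,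
      PositiveLinearMap.gnsStarAlgHom, PositiveLinearMap.leftMulMapPreGNS]
  rw [← hξ]
  -- for `ω = 0` the GNS space is zero, and its amplification is not infinite dimensional
  rcases subsingleton_or_nontrivial ω.GNS with hs | hs
  · simp [Subsingleton.elim ξ 0]
  · have h0 := h _ (not_finiteDimensional_lp (H := ω.GNS)) ((amplifyHom ω.GNS).comp ω.gnsStarAlgHom)
    rw [ContinuousLinearMap.nonneg_iff_isPositive] at h0
    have h1 := h0.inner_nonneg_right (lp.single (E := fun _ : ℕ => ω.GNS) 2 0 ξ)
    rw [lp.inner_single_left] at h1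
    simpa [amplifyHom] using h1

/-! ### Transfer of operator convexity and operator monotonicity to C⋆-algebras -/

open scoped CStarAlgebra in
theorem StarAlgHom.map_cfc_real {D E : Type*} [CStarAlgebra D] [CStarAlgebra E] (π : D →⋆ₐ[ℂ] E)
    (f : ℝ → ℝ) (a : D) (hf : ContinuousOn f (spectrum ℝ a)) (ha : IsSelfAdjoint a) :
    π (cfc f a) = cfc f (π a) :=
  π.map_cfc f a hf (map_continuous π) ha (ha.map π)

theorem StarAlgHom.spectrum_real_subset {D E : Type*} [CStarAlgebra D] [CStarAlgebra E]
    (π : D →⋆ₐ[ℂ] E) (a : D) : spectrum ℝ (π a) ⊆ spectrum ℝ a :=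
  AlgHom.spectrum_apply_subset (π.restrictScalars ℝ) a

theorem spectrum_subset_Icc_iff {D : Type*} [CStarAlgebra D] [PartialOrder D] [StarOrderedRing D]
    {a : D} (ha : IsSelfAdjoint a) {m M : ℝ} :
    spectrum ℝ a ⊆ Set.Icc m M ↔ algebraMap ℝ D m ≤ a ∧ a ≤ algebraMap ℝ D M := by
  rw [algebraMap_le_iff_le_spectrum, le_algebraMap_iff_spectrum_le]
  exact ⟨fun h => ⟨fun r hr => (h hr).1, fun r hr => (h hr).2⟩, fun h r hr => ⟨h.1 r hr, h.2 r hr⟩⟩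

/-- Operator convexity, assumed for operators on infinite dimensional Hilbert spaces, holds in every
unital C⋆-algebra. -/
theorem OperatorConvexOn.cfc_le {m M : ℝ} {f : ℝ → ℝ}
    (hf : OperatorConvexOn.{u} (Set.Icc m M) f)
    {D : Type u} [CStarAlgebra D] [PartialOrder D] [StarOrderedRing D] {x y : D}
    (hx : IsSelfAdjoint x) (hy : IsSelfAdjoint y) (hxI : spectrum ℝ x ⊆ Set.Icc m M)
    (hyI : spectrum ℝ y ⊆ Set.Icc m M) {c : ℝ} (hc : c ∈ Set.Icc (0 : ℝ) 1) :
    cfc f (c • x + (1 - c) • y) ≤ c • cfc f x + (1 - c) • cfc f y := by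
  have hxy' : IsSelfAdjoint (c • x + (1 - c) • y) :=
    ((IsSelfAdjoint.all c).smul hx).add ((IsSelfAdjoint.all (1 - c)).smul hy)
  have hxy : spectrum ℝ (c • x + (1 - c) • y) ⊆ Set.Icc m M := by
    have h1 := (spectrum_subset_Icc_iff hx).1 hxI
    have h2 := (spectrum_subset_Icc_iff hy).1 hyI
    have hc' : 0 ≤ 1 - c := sub_nonneg.2 hc.2
    have hr (r : ℝ) : algebraMap ℝ D r = c • algebraMap ℝ D r + (1 - c) • algebraMap ℝ D r := by
      rw [← add_smul]; simp
    refine (spectrum_subset_Icc_iff hxy').2 ⟨?_, ?_⟩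
    · rw [hr m]
      exact add_le_add (smul_le_smul_of_nonneg_left h1.1 hc.1)
        (smul_le_smul_of_nonneg_left h2.1 hc')
    · rw [hr M]
      exact add_le_add (smul_le_smul_of_nonneg_left h1.2 hc.1)
        (smul_le_smul_of_nonneg_left h2.2 hc')
  rw [← sub_nonneg]
  refine nonneg_of_forall_representation fun H _ _ _ hH π => ?_
  have hπ (r : ℝ) (a : D) : π (r • a) = r • π a := map_smul (π.restrictScalars ℝ) r a
  rw [map_sub, map_add, hπ, hπ, π.map_cfc_real f _ (hf.1.mono hxI) hx,
    π.map_cfc_real f _ (hf.1.mono hyI) hy, π.map_cfc_real f _ (hf.1.mono hxy) hxy', map_add,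
    hπ, hπ, sub_nonneg]
  exact hf.2 H hH _ _ (hx.map π) (hy.map π) ((π.spectrum_real_subset x).trans hxI)
    ((π.spectrum_real_subset y).trans hyI) c hc

theorem AdmissiblePair.map {U V : Set ℝ} {D E : Type u} [CStarAlgebra D] [CStarAlgebra E]
    {x y : D} (h : AdmissiblePair U V x y) (π : D →⋆ₐ[ℂ] E) :
    AdmissiblePair U V (π x) (π y) :=
  ⟨h.1.map π, h.2.1.map π, (π.spectrum_real_subset x).trans h.2.2.1,
    (π.spectrum_real_subset y).trans h.2.2.2⟩

open scoped CStarAlgebra in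
/-- Operator maps given by an expression commute with unital ⋆-homomorphisms. -/
theorem IsOperatorVersion.map {U V : Set ℝ} {F : ℝ → ℝ → ℝ} {Φ : OperatorMap.{u}}
    (hΦ : IsOperatorVersion U V F Φ) {D E : Type u} [CStarAlgebra D] [CStarAlgebra E]
    (π : D →⋆ₐ[ℂ] E) {x y : D} (hxy : AdmissiblePair U V x y) :
    π (Φ D x y) = Φ E (π x) (π y) := by
  induction hΦ with
  | const r => exact AlgHomClass.commutes (π.restrictScalars ℝ) r
  | fst => rfl
  | snd => rfl
  | add F G Φ Ψ _ _ h1 h2 => simp only [map_add, h1, h2]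
  | mul F G Φ Ψ _ _ h1 h2 => simp only [map_mul, h1, h2]
  | comp h F Φ _ hh ih =>
    obtain ⟨h1, h2⟩ := hh D x y hxy
    rw [π.map_cfc_real h _ h2 h1, ih]
  | lim Fn Φn F Φ _ _ hlim ih =>
    have h1 := ((map_continuous π).tendsto _).comp (hlim D x y hxy)
    have h2 := hlim E _ _ (hxy.map π)
    refine tendsto_nhds_unique h1 (h2.congr fun n => ?_)
    exact (ih n).symm

/-- Operator monotonicity, assumed for operators on infinite dimensional Hilbert spaces, holds in
every unital C⋆-algebra. -/
theorem OperatorMonotoneFst.apply_le {U V : Set ℝ} {F : ℝ → ℝ → ℝ} {Φ : OperatorMap.{u}}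
    (hmono : OperatorMonotoneFst U V Φ) (hΦ : IsOperatorVersion U V F Φ)
    {D : Type u} [CStarAlgebra D] [PartialOrder D] [StarOrderedRing D] {x x' y : D}
    (hxy : AdmissiblePair U V x y) (hxy' : AdmissiblePair U V x' y) (hle : x ≤ x') :
    Φ D x y ≤ Φ D x' y := by
  rw [← sub_nonneg]
  refine nonneg_of_forall_representation fun H _ _ _ hH π => ?_
  rw [map_sub, hΦ.map π hxy, hΦ.map π hxy', sub_nonneg]
  refine hmono H hH _ _ _ (hxy.map π) (hxy'.map π) ?_
  rw [← sub_nonneg, ← map_sub]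
  exact map_nonneg π (sub_nonneg.2 hle)

/-! ### Matrix algebras and the operator Jensen inequality for finite sums -/

/-- Square matrices over a C⋆-algebra, with the C⋆-algebra structure of `CStarMatrix`. The topology,
norm and algebra structures are all those derived from one `CStarAlgebra` instance, as the instances
for the continuous functional calculus require. -/
def MatrixAlgebra (n : Type*) (D : Type*) := CStarMatrix n n D

namespace MatrixAlgebra

theorem ext {n D : Type*} {P Q : MatrixAlgebra n D} (h : ∀ i j, P i j = Q i j) : P = Q :=
  CStarMatrix.ext h

variable {n : Type*} [Fintype n] [DecidableEq n] {D : Type*} [CStarAlgebra D]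

noncomputable instance [PartialOrder D] [StarOrderedRing D] : CStarAlgebra (MatrixAlgebra n D) :=
  inferInstanceAs (CStarAlgebra (CStarMatrix n n D))

variable [PartialOrder D] [StarOrderedRing D]

noncomputable instance : PartialOrder (MatrixAlgebra n D) := CStarAlgebra.spectralOrder _

instance : StarOrderedRing (MatrixAlgebra n D) := CStarAlgebra.spectralOrderedRing _

@[simp]
theorem mul_apply (P Q : MatrixAlgebra n D) (i j : n) : (P * Q) i j = ∑ k, P i k * Q k j := rfl

theorem one_apply (i j : n) : (1 : MatrixAlgebra n D) i j = if i = j then 1 else 0 := rfl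

@[simp]
theorem add_apply (P Q : MatrixAlgebra n D) (i j : n) : (P + Q) i j = P i j + Q i j := rfl

@[simp]
theorem sub_apply (P Q : MatrixAlgebra n D) (i j : n) : (P - Q) i j = P i j - Q i j := rfl

@[simp]
theorem smul_apply (r : ℝ) (P : MatrixAlgebra n D) (i j : n) : (r • P) i j = r • P i j := rfl

@[simp]
theorem star_apply (P : MatrixAlgebra n D) (i j : n) : (star P) i j = star (P j i) := rfl

theorem algebraMap_apply_self (r : ℝ) (i : n) :
    (algebraMap ℝ (MatrixAlgebra n D) r) i i = algebraMap ℝ D r := by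
  simp [Algebra.algebraMap_eq_smul_one, one_apply]

variable (n D) in
/-- Diagonal matrices, as a unital ⋆-homomorphism `Dⁿ → Mₙ(D)`. -/
noncomputable def diagonalHom : (n → D) →⋆ₐ[ℂ] MatrixAlgebra n D where
  toFun v := (CStarMatrix.ofMatrix (Matrix.diagonal v))
  map_one' := Matrix.diagonal_one
  map_mul' v w := (Matrix.diagonal_mul_diagonal v w).symm
  map_zero' := Matrix.diagonal_zero
  map_add' v w := (Matrix.diagonal_add v w).symm
  commutes' r := by
    simp only [Algebra.algebraMap_eq_smul_one]
    exact (Matrix.diagonal_smul r (1 : n → D)).trans (congrArg (r • ·) Matrix.diagonal_one)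
  map_star' v := (Matrix.diagonal_conjTranspose v).symm

theorem diagonalHom_apply (v : n → D) (i j : n) :
    diagonalHom n D v i j = if i = j then v i else 0 := rfl

@[simp]
theorem diagonalHom_apply_self (v : n → D) (i : n) : diagonalHom n D v i i = v i := by
  simp [diagonalHom_apply]

theorem isSelfAdjoint_diagonalHom {v : n → D} (hv : ∀ i, IsSelfAdjoint (v i)) :
    IsSelfAdjoint (diagonalHom n D v) :=
  IsSelfAdjoint.map (f := diagonalHom n D) (x := v) (funext hv)

theorem spectrum_diagonalHom_subset {v : n → D} {s : Set ℝ} (hs : ∀ i, spectrum ℝ (v i) ⊆ s) :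
    spectrum ℝ (diagonalHom n D v) ⊆ s := by
  have h : spectrum ℝ v = ⋃ i, spectrum ℝ (v i) := Pi.spectrum_eq v
  exact ((StarAlgHom.spectrum_real_subset _ _).trans h.subset).trans (Set.iUnion_subset hs)

theorem cfc_diagonalHom {f : ℝ → ℝ} {v : n → D} (hv : ∀ i, IsSelfAdjoint (v i)) {s : Set ℝ}
    (hf : ContinuousOn f s) (hs : ∀ i, spectrum ℝ (v i) ⊆ s) :
    cfc f (diagonalHom n D v) = diagonalHom n D fun i => cfc f (v i) := by
  have h : spectrum ℝ v = ⋃ i, spectrum ℝ (v i) := Pi.spectrum_eq v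
  have hf' : ContinuousOn f (spectrum ℝ v) := hf.mono (h.subset.trans (Set.iUnion_subset hs))
  rw [← StarAlgHom.map_cfc_real _ f v hf' (funext hv)]
  congr 1
  funext i
  exact StarAlgHom.map_cfc_real (Pi.evalStarAlgHom ℂ (fun _ : n => D) i) f v hf' (funext hv)

theorem apply_self_nonneg {P : MatrixAlgebra n D} (hP : 0 ≤ P) (i : n) : 0 ≤ P i i := by
  obtain ⟨N, rfl⟩ := CStarAlgebra.nonneg_iff_eq_star_mul_self.1 hP
  rw [mul_apply]
  exact Finset.sum_nonneg fun j _ => by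
    rw [star_apply]
    exact star_mul_self_nonneg _

theorem apply_self_mono {P Q : MatrixAlgebra n D} (h : P ≤ Q) (i : n) : P i i ≤ Q i i := by
  have := apply_self_nonneg (sub_nonneg.2 h) i
  rwa [sub_apply, sub_nonneg] at this

end MatrixAlgebra

open MatrixAlgebra

theorem cfc_star_mul_mul {D : Type*} [CStarAlgebra D] {w : D} (hw : w ∈ unitary D) {f : ℝ → ℝ}
    {a : D} (hf : ContinuousOn f (spectrum ℝ a)) (ha : IsSelfAdjoint a) :
    cfc f (star w * a * w) = star w * cfc f a * w := by
  have := StarAlgHom.map_cfc_real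
    (Unitary.conjStarAlgAut ℂ D (star ⟨w, hw⟩) : D →⋆ₐ[ℂ] D) f a hf ha
  simpa using this.symm

theorem spectrum_star_mul_mul_subset {D : Type*} [CStarAlgebra D] {w : D} (hw : w ∈ unitary D)
    (a : D) : spectrum ℝ (star w * a * w) ⊆ spectrum ℝ a := by
  have := StarAlgHom.spectrum_real_subset
    (Unitary.conjStarAlgAut ℂ D (star ⟨w, hw⟩) : D →⋆ₐ[ℂ] D) a
  simpa using this

/-- The symmetry `diag(1, -1)`. -/
noncomputable def signMatrix (D : Type*) [CStarAlgebra D] [PartialOrder D]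
    [StarOrderedRing D] : MatrixAlgebra (Fin 2) D :=
  diagonalHom (Fin 2) D ![1, -1]

theorem signMatrix_mem_unitary (D : Type*) [CStarAlgebra D] [PartialOrder D]
    [StarOrderedRing D] :
    signMatrix D ∈ unitary (MatrixAlgebra (Fin 2) D) := by
  rw [Unitary.mem_iff]
  constructor <;>
  · refine MatrixAlgebra.ext fun i j => ?_
    fin_cases i <;> fin_cases j <;>
      simp [signMatrix, mul_apply, star_apply, diagonalHom_apply, one_apply]

/-- Averaging a `2 × 2` matrix with its conjugate by `diag(1, -1)` removes the off-diagonal entries. -/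
theorem half_smul_add_signMatrix {D : Type*} [CStarAlgebra D] [PartialOrder D]
    [StarOrderedRing D]
    (P : MatrixAlgebra (Fin 2) D) :
    (1 / 2 : ℝ) • P + (1 - 1 / 2 : ℝ) • (star (signMatrix D) * P * signMatrix D) =
      diagonalHom (Fin 2) D fun i => P i i := by
  refine MatrixAlgebra.ext fun i j => ?_
  have h (d : D) : (2⁻¹ : ℝ) • d + (1 - 2⁻¹ : ℝ) • d = d := by
    rw [← add_smul]; norm_num
  have h' (d : D) : (2⁻¹ : ℝ) • d + -((1 - 2⁻¹ : ℝ) • d) = 0 := by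
    rw [← smul_neg, ← neg_neg ((2⁻¹ : ℝ) • d), ← smul_neg]; norm_num
  fin_cases i <;> fin_cases j <;>
    simp [signMatrix, mul_apply, star_apply, diagonalHom_apply, Fin.sum_univ_two, h, h']

/-- Halmos' unitary dilation of a partial isometry `v`. -/
noncomputable def halmos {D : Type*} [CStarAlgebra D] [PartialOrder D]
    [StarOrderedRing D] (v : D) : MatrixAlgebra (Fin 2) D :=
  CStarMatrix.ofMatrix !![v, 1 - v * star v; 1 - star v * v, -star v]

section

variable {D : Type*} [CStarAlgebra D] [PartialOrder D] [StarOrderedRing D] (v : D)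

@[simp] theorem halmos_zero_zero : halmos v 0 0 = v := rfl
@[simp] theorem halmos_zero_one : halmos v 0 1 = 1 - v * star v := rfl
@[simp] theorem halmos_one_zero : halmos v 1 0 = 1 - star v * v := rfl
@[simp] theorem halmos_one_one : halmos v 1 1 = -star v := rfl

end

theorem halmos_mem_unitary {D : Type*} [CStarAlgebra D] [PartialOrder D]
    [StarOrderedRing D] {v : D} (hv : v * star v * v = v) :
    halmos v ∈ unitary (MatrixAlgebra (Fin 2) D) := by
  have hv' : star v * (v * star v) = star v := by
    simpa [mul_assoc] using congrArg star hv
  have hv2 : v * (star v * v) = v := by rw [← mul_assoc, hv]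
  rw [Unitary.mem_iff]
  constructor <;>
  · refine MatrixAlgebra.ext fun i j => ?_
    fin_cases i <;> fin_cases j <;>
      simp [Fin.sum_univ_two, one_apply, mul_sub, sub_mul,
        mul_assoc, hv', hv2]

/-- The Hansen–Pedersen form of Jensen's inequality for a partial isometry `v`. The element
`v⋆ x v + c (1 - v⋆ v)` is the corner of a unitary conjugate of `diag(x, c)`; the diagonal part of a
`2 × 2` matrix is the mean of two unitary conjugates, so that operator convexity in the algebra of
`2 × 2` matrices applies. -/
theorem OperatorConvexOn.cfc_partialIsometry_le {m M : ℝ} {f : ℝ → ℝ}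
    (hf : OperatorConvexOn.{u} (Set.Icc m M) f)
    {D : Type u} [CStarAlgebra D] [PartialOrder D] [StarOrderedRing D] {x v : D}
    (hx : IsSelfAdjoint x) (hxI : spectrum ℝ x ⊆ Set.Icc m M) (hv : v * star v * v = v)
    {c : ℝ} (hc : c ∈ Set.Icc m M) :
    cfc f (star v * x * v + c • (1 - star v * v)) ≤
      star v * cfc f x * v + f c • (1 - star v * v) := by
  have hproj : (1 - star v * v) * (1 - star v * v) = 1 - star v * v := by
    have hv2 : v * (star v * v) = v := by rw [← mul_assoc, hv]
    simp [mul_sub, sub_mul, mul_assoc, hv2]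
  have hentry (y : D) (r : ℝ) :
      (star (halmos v) * diagonalHom (Fin 2) D ![y, algebraMap ℝ D r] * halmos v) 0 0 =
        star v * y * v + r • (1 - star v * v) := by
    -- the corner involves the square of the projection `1 - v⋆ v`
    rw [← hproj]
    simp [Fin.sum_univ_two, diagonalHom_apply,
      Algebra.algebraMap_eq_smul_one]
  have hZ : ∀ i, IsSelfAdjoint ((![x, algebraMap ℝ D c] : Fin 2 → D) i) := by
    intro i
    fin_cases i
    · exact hx
    · exact (IsSelfAdjoint.all c).algebraMap D
  have hZI : ∀ i, spectrum ℝ ((![x, algebraMap ℝ D c] : Fin 2 → D) i) ⊆ Set.Icc m M := by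
    intro i
    fin_cases i
    · exact hxI
    · rcases subsingleton_or_nontrivial D with h | h
      · simp [spectrum.of_subsingleton]
      · simpa [spectrum.scalar_eq] using hc
  have hW := halmos_mem_unitary hv
  have hS := signMatrix_mem_unitary D
  set Z := diagonalHom (Fin 2) D ![x, algebraMap ℝ D c] with hZdef
  have hZs : IsSelfAdjoint Z := isSelfAdjoint_diagonalHom hZ
  have hZIs : spectrum ℝ Z ⊆ Set.Icc m M := spectrum_diagonalHom_subset hZI
  set P := star (halmos v) * Z * halmos v with hP
  have hPs : IsSelfAdjoint P := hZs.conjugate' _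
  have hPI : spectrum ℝ P ⊆ Set.Icc m M := (spectrum_star_mul_mul_subset hW Z).trans hZIs
  have hcfcP : cfc f P = star (halmos v) * cfc f Z * halmos v :=
    cfc_star_mul_mul hW (hf.1.mono hZIs) hZs
  have hQI := (spectrum_star_mul_mul_subset hS P).trans hPI
  -- convexity for `P` and its conjugate by `diag(1, -1)`, whose mean is the diagonal part of `P`
  have hle := hf.cfc_le hPs (hPs.conjugate' (signMatrix D)) hPI hQI (c := 1 / 2) (by norm_num)
  rw [cfc_star_mul_mul hS (hf.1.mono hPI) hPs, half_smul_add_signMatrix,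
    half_smul_add_signMatrix] at hle
  have hentrySA (i : Fin 2) : IsSelfAdjoint (P i i) := congrFun (congrFun hPs i) i
  have hentryI (i : Fin 2) : spectrum ℝ (P i i) ⊆ Set.Icc m M := by
    have h := (spectrum_subset_Icc_iff hPs).1 hPI
    refine (spectrum_subset_Icc_iff (hentrySA i)).2 ⟨?_, ?_⟩
    · simpa [algebraMap_apply_self] using apply_self_mono h.1 i
    · simpa [algebraMap_apply_self] using apply_self_mono h.2 i
  rw [cfc_diagonalHom hentrySA hf.1 hentryI, hcfcP, hZdef, cfc_diagonalHom hZ hf.1 hZI] at hle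
  have h0 := apply_self_mono hle 0
  have hcf : (fun i => cfc f ((![x, algebraMap ℝ D c] : Fin 2 → D) i)) =
      ![cfc f x, algebraMap ℝ D (f c)] := by
    funext i
    fin_cases i
    · rfl
    · exact cfc_algebraMap c f
  rw [hcf, diagonalHom_apply_self, diagonalHom_apply_self, hentry, hP, hentry] at h0
  exact h0

/-- Jensen's operator inequality for a finite resolution `∑ eᵢ = 1` into positive elements. The matrix
`v` whose column `0` consists of the `√eᵢ` is a partial isometry with `v⋆ diag(s) v = ∑ sᵢ eᵢ` in the
corner, so this is the corner of `OperatorConvexOn.cfc_partialIsometry_le` in the matrix algebra. -/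
theorem OperatorConvexOn.cfc_sum_smul_le {m M : ℝ} {f : ℝ → ℝ}
    (hf : OperatorConvexOn.{u} (Set.Icc m M) f)
    {D : Type u} [CStarAlgebra D] [PartialOrder D] [StarOrderedRing D] {k : ℕ}
    {e : Fin (k + 1) → D} (he : ∀ i, 0 ≤ e i) (hsum : ∑ i, e i = 1)
    {s : Fin (k + 1) → ℝ} (hs : ∀ i, s i ∈ Set.Icc m M) :
    cfc f (∑ i, s i • e i) ≤ ∑ i, f (s i) • e i := by
  let v : MatrixAlgebra (Fin (k + 1)) D :=
    CStarMatrix.ofMatrix fun i j => if j = 0 then CFC.sqrt (e i) else 0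
  have hv_apply (i j) : v i j = if j = 0 then CFC.sqrt (e i) else 0 := rfl
  have hsqrt (i) : star (CFC.sqrt (e i)) = CFC.sqrt (e i) :=
    (IsSelfAdjoint.of_nonneg (CFC.sqrt_nonneg (e i))).star_eq
  let S (r : Fin (k + 1) → ℝ) : MatrixAlgebra (Fin (k + 1)) D :=
    diagonalHom _ D fun i => algebraMap ℝ D (r i)
  have hS_conj (r : Fin (k + 1) → ℝ) :
      star v * S r * v = diagonalHom _ D (Pi.single 0 (∑ i, r i • e i)) := by
    refine MatrixAlgebra.ext fun i j => ?_
    have : ∀ l, CFC.sqrt (e l) * (r l • (1 : D)) * CFC.sqrt (e l) = r l • e l := fun l => by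
      simp [CFC.sqrt_mul_sqrt_self (e l) (he l)]
    by_cases hi : i = 0 <;> by_cases hj : j = 0
    · subst hi hj
      simp [S, hv_apply, hsqrt, diagonalHom_apply, Algebra.algebraMap_eq_smul_one,
        CFC.sqrt_mul_sqrt_self (e _) (he _)]
    all_goals
      simp [S, hv_apply, diagonalHom_apply, hi, hj]
    all_goals
      intro h; subst h; simp_all
  have hone : S 1 = 1 := by
    simp only [S, Pi.one_apply, map_one]
    exact map_one (diagonalHom _ D)
  -- conjugating the identity matrix gives the projection onto the corner
  have hvv : star v * v = diagonalHom _ D (Pi.single 0 1) := by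
    simpa [hone, hsum] using hS_conj 1
  have hv : v * star v * v = v := by
    rw [mul_assoc, hvv]
    refine MatrixAlgebra.ext fun i j => ?_
    by_cases hj : j = 0
    · subst hj; simp [hv_apply, diagonalHom_apply]
    · simp [hv_apply, diagonalHom_apply, hj]
  have hSs (i : Fin (k + 1)) : IsSelfAdjoint (algebraMap ℝ D (s i)) :=
    (IsSelfAdjoint.all (s i)).algebraMap D
  have hSI (i : Fin (k + 1)) : spectrum ℝ (algebraMap ℝ D (s i)) ⊆ Set.Icc m M := by
    rcases subsingleton_or_nontrivial D with h | h
    · simp [spectrum.of_subsingleton]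
    · simpa [spectrum.scalar_eq] using hs i
  -- the value `s 0` on the complement of the corner is immaterial: any point of `[m, M]` would do
  have key := hf.cfc_partialIsometry_le (isSelfAdjoint_diagonalHom hSs)
    (spectrum_diagonalHom_subset hSI) hv (hs 0)
  have hSf : cfc f (S s) = S fun i => f (s i) := by
    refine (cfc_diagonalHom hSs hf.1 hSI).trans ?_
    simp only [S, cfc_algebraMap]
  have hcorner (a : D) (r : ℝ) : diagonalHom (Fin (k + 1)) D (Pi.single 0 a) +
      r • (1 - diagonalHom (Fin (k + 1)) D (Pi.single 0 1)) =
        diagonalHom _ D (Function.update (fun _ => algebraMap ℝ D r) 0 a) := by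
    refine MatrixAlgebra.ext fun i j => ?_
    by_cases hij : i = j
    · subst hij
      by_cases hi : i = 0
      · subst hi; simp [one_apply]
      · simp [one_apply, hi, Algebra.algebraMap_eq_smul_one]
    · simp [one_apply, diagonalHom_apply, hij]
  change cfc f (star v * S s * v + _) ≤ star v * cfc f (S s) * v + _ at key
  rw [hSf, hS_conj, hS_conj, hvv, hcorner, hcorner] at key
  have hmean : IsSelfAdjoint (∑ i, s i • e i) :=
    isSelfAdjoint_sum _ fun i _ => (IsSelfAdjoint.all (s i)).smul (.of_nonneg (he i))
  have hbound (r : ℝ) : algebraMap ℝ D r = ∑ i, r • e i := by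
    rw [← Finset.smul_sum, hsum, Algebra.algebraMap_eq_smul_one]
  have hmeanI : spectrum ℝ (∑ i, s i • e i) ⊆ Set.Icc m M := by
    refine (spectrum_subset_Icc_iff hmean).2 ⟨?_, ?_⟩
    · rw [hbound m]
      exact Finset.sum_le_sum fun i _ => smul_le_smul_of_nonneg_right (hs i).1 (he i)
    · rw [hbound M]
      exact Finset.sum_le_sum fun i _ => smul_le_smul_of_nonneg_right (hs i).2 (he i)
  rw [cfc_diagonalHom (s := Set.Icc m M) _ hf.1] at key
  · simpa using apply_self_mono key 0
  · intro i
    by_cases hi : i = 0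
    · subst hi; simpa using hmeanI
    · simpa [hi] using hSI 0
  · intro i
    by_cases hi : i = 0
    · subst hi; simpa using hmean
    · simpa [hi] using hSs 0

/-! ### The Davis–Choi inequality for maps on `C([m, M], ℝ)` -/

/-- The identity function of `[m, M]`, as an element of `C([m, M], ℝ)`. -/
def coordIcc (m M : ℝ) : C(Set.Icc m M, ℝ) := ⟨Subtype.val, continuous_subtype_val⟩

/-- The restriction to `[m, M]` of a function continuous there, as an element of `C([m, M], ℝ)`. -/
def restrictIcc {m M : ℝ} {f : ℝ → ℝ} (hf : ContinuousOn f (Set.Icc m M)) : C(Set.Icc m M, ℝ) :=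
  ⟨fun s => f s, continuousOn_iff_continuous_domRestrict.1 hf⟩

/-- The affine map `[m, M] → [0, 1]`; it is constantly `0` if `m = M`. -/
noncomputable def toUnitInterval (m M : ℝ) : C(Set.Icc m M, unitInterval) where
  toFun s := ⟨(s - m) / (M - m), div_nonneg (sub_nonneg.2 s.2.1) (sub_nonneg.2 (s.2.1.trans s.2.2)),
    div_le_one_of_le₀ (sub_le_sub_right s.2.2 m) (sub_nonneg.2 (s.2.1.trans s.2.2))⟩
  continuous_toFun := by fun_prop

/-- The affine map `[0, 1] → [m, M]`. -/
noncomputable def ofUnitInterval {m M : ℝ} (hmM : m ≤ M) : C(unitInterval, Set.Icc m M) where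
  toFun r := ⟨m + (M - m) * r, by
    have := mul_nonneg (sub_nonneg.2 hmM) r.2.1
    linarith, by
    have := mul_le_mul_of_nonneg_left r.2.2 (sub_nonneg.2 hmM)
    linarith⟩
  continuous_toFun := by fun_prop

theorem ofUnitInterval_toUnitInterval {m M : ℝ} (hmM : m ≤ M) (s : Set.Icc m M) :
    ofUnitInterval hmM (toUnitInterval m M s) = s := by
  apply Subtype.ext
  change m + (M - m) * ((s - m) / (M - m)) = s
  rcases hmM.eq_or_lt with h | h
  · have h1 := s.2.1
    have h2 := s.2.2
    have : (s : ℝ) = m := by linarith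
    simp [this]
  · have : M - m ≠ 0 := (sub_pos.2 h).ne'
    field_simp
    ring

/-- Bernstein polynomials reproduce the identity function. -/
theorem sum_bernstein_mul_z {n : ℕ} (hn : n ≠ 0) (r : unitInterval) :
    ∑ k : Fin (n + 1), (bernstein.z k : ℝ) * bernstein n k r = r := by
  have h := congr(Polynomial.aeval (r : ℝ) $(bernsteinPolynomial.sum_smul ℝ n) / n)
  have hn' : (n : ℝ) ≠ 0 := Nat.cast_ne_zero.2 hn
  simp only [Finset.sum_range, map_sum, nsmul_eq_mul, Polynomial.aeval_X,
    mul_div_cancel_left₀ _ hn', map_mul, map_natCast] at h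
  rw [← h, Finset.sum_div]
  refine Finset.sum_congr rfl fun k _ => ?_
  have : bernstein n k r = Polynomial.aeval (r : ℝ) (bernsteinPolynomial ℝ n k) := by
    simp [bernstein, Polynomial.toContinuousMapOn, Polynomial.aeval_def]
  rw [this, bernstein.z]
  simp only
  ring

/-- The Davis–Choi inequality `f(Ψ(id)) ≤ Ψ(f)` for a unital positive linear map `Ψ` on
`C([m, M], ℝ)`. The Bernstein polynomials form a partition of unity that reproduces the identity
exactly and `f` up to `ε`, which reduces the claim to finite sums. -/
theorem OperatorConvexOn.map_coordIcc_le {m M : ℝ} (hmM : m ≤ M) {f : ℝ → ℝ}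
    (hf : OperatorConvexOn.{u} (Set.Icc m M) f)
    {D : Type u} [CStarAlgebra D] [PartialOrder D] [StarOrderedRing D]
    (Ψ : C(Set.Icc m M, ℝ) →ₗ[ℝ] D) (hΨ : ∀ h, 0 ≤ h → 0 ≤ Ψ h) (hone : Ψ 1 = 1) :
    cfc f (Ψ (coordIcc m M)) ≤ Ψ (restrictIcc hf.1) := by
  set F : C(unitInterval, ℝ) := (restrictIcc hf.1).comp (ofUnitInterval hmM) with hF
  have hmono {h k : C(Set.Icc m M, ℝ)} (hk : h ≤ k) : Ψ h ≤ Ψ k := by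
    rw [← sub_nonneg, ← map_sub]
    exact hΨ _ (sub_nonneg.2 hk)
  have hbound (ε : ℝ) (hε : 0 < ε) :
      cfc f (Ψ (coordIcc m M)) ≤ Ψ (restrictIcc hf.1) + ε • (1 : D) := by
    obtain ⟨n, hn, hn0⟩ := ((Metric.tendsto_nhds.1 (bernsteinApproximation_uniform F) ε hε).and
      (eventually_ne_atTop 0)).exists
    let b (k : Fin (n + 1)) : C(Set.Icc m M, ℝ) := (bernstein n k).comp (toUnitInterval m M)
    let s (k : Fin (n + 1)) : Set.Icc m M := ofUnitInterval hmM (bernstein.z k)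
    have hb (k) : 0 ≤ b k := fun r => bernstein_nonneg
    have hsum : ∑ k, b k = 1 := by
      ext r
      simp [b, ContinuousMap.sum_apply]
    have hcoord : ∑ k, (s k : ℝ) • b k = coordIcc m M := by
      ext r
      have h1 := bernstein.probability n (toUnitInterval m M r)
      have h2 := sum_bernstein_mul_z hn0 (toUnitInterval m M r)
      have h3 := congrArg Subtype.val (ofUnitInterval_toUnitInterval hmM r)
      change m + (M - m) * (toUnitInterval m M r : ℝ) = r at h3
      have : ∀ k, (s k : ℝ) * bernstein n k (toUnitInterval m M r) =
          m * bernstein n k (toUnitInterval m M r) +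
            (M - m) * ((bernstein.z k : ℝ) * bernstein n k (toUnitInterval m M r)) := by
        intro k
        change (m + (M - m) * (bernstein.z k : ℝ)) * _ = _
        ring
      simp only [ContinuousMap.sum_apply, ContinuousMap.smul_apply, smul_eq_mul, b,
        ContinuousMap.comp_apply, this, Finset.sum_add_distrib, ← Finset.mul_sum, h1, h2]
      simpa [coordIcc] using h3
    have happrox : ∑ k : Fin (n + 1), f (s k) • b k ≤ restrictIcc hf.1 + ε • 1 := by
      intro r
      change (∑ k, f (s k) • b k) r ≤ (restrictIcc hf.1 + ε • 1) r
      have h1 := (ContinuousMap.dist_lt_iff hε).1 hn (toUnitInterval m M r)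
      rw [bernsteinApproximation.apply, Real.dist_eq] at h1
      have h2 := (abs_lt.1 h1).2
      simp only [hF, ContinuousMap.comp_apply, ofUnitInterval_toUnitInterval, smul_eq_mul] at h2
      simp only [ContinuousMap.sum_apply, ContinuousMap.smul_apply, smul_eq_mul, b,
        ContinuousMap.comp_apply, ContinuousMap.add_apply, ContinuousMap.one_apply, mul_one]
      have h3 : ∑ k : Fin (n + 1), f (s k) * bernstein n k (toUnitInterval m M r) =
          ∑ k : Fin (n + 1), bernstein n k (toUnitInterval m M r) * restrictIcc hf.1 (s k) :=
        Finset.sum_congr rfl fun k _ => mul_comm _ _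
      rw [h3]
      linarith
    calc cfc f (Ψ (coordIcc m M)) = cfc f (∑ k, (s k : ℝ) • Ψ (b k)) := by
          rw [← hcoord]; simp
      _ ≤ ∑ k, f (s k) • Ψ (b k) := hf.cfc_sum_smul_le (fun k => hΨ _ (hb k))
          (by rw [← map_sum, hsum, hone]) fun k => (s k).2
      _ = Ψ (∑ k, f (s k) • b k) := by simp
      _ ≤ Ψ (restrictIcc hf.1 + ε • 1) := hmono happrox
      _ = Ψ (restrictIcc hf.1) + ε • (1 : D) := by simp [hone]
  refine ge_of_tendsto (x := 𝓝[>] (0 : ℝ)) (f := fun ε : ℝ => Ψ (restrictIcc hf.1) + ε • (1 : D)) ?_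
    (eventually_mem_nhdsWithin.mono hbound)
  refine Tendsto.mono_left ?_ nhdsWithin_le_nhds
  have : Continuous fun ε : ℝ => Ψ (restrictIcc hf.1) + ε • (1 : D) := by fun_prop
  simpa using this.tendsto 0

/-! ### Integration of fields of positive linear maps -/

theorem norm_le_of_neg_le_of_le {D : Type*} [CStarAlgebra D] [PartialOrder D] [StarOrderedRing D]
    {a : D} (ha : IsSelfAdjoint a) {r : ℝ} (hr : 0 ≤ r) (h1 : algebraMap ℝ D (-r) ≤ a)
    (h2 : a ≤ algebraMap ℝ D r) : ‖a‖ ≤ r := by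
  have h := (spectrum_subset_Icc_iff ha).2 ⟨h1, h2⟩
  rw [← cfc_id ℝ a]
  exact norm_cfc_le hr fun s hs => abs_le.2 (h hs)

variable {T : Type w} [TopologicalSpace T]
  {A : Type v} [CStarAlgebra A] [PartialOrder A] [StarOrderedRing A]
  {B : Type u} [CStarAlgebra B] [PartialOrder B] [StarOrderedRing B]

theorem PositiveLinearMap.norm_apply_le_of_isSelfAdjoint (φ : A →ₚ[ℂ] B) {a : A}
    (ha : IsSelfAdjoint a) : ‖φ a‖ ≤ ‖φ 1‖ * ‖a‖ := by
  have hφa : IsSelfAdjoint (φ a) := ha.map φ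
  have hone : 0 ≤ φ 1 := φ.map_nonneg zero_le_one
  have hle : φ (algebraMap ℝ A ‖a‖) ≤ algebraMap ℝ B (‖φ 1‖ * ‖a‖) := by
    rw [Algebra.algebraMap_eq_smul_one, φ.map_smul_of_tower, mul_comm, map_mul,
      ← Algebra.smul_def]
    exact smul_le_smul_of_nonneg_left (IsSelfAdjoint.of_nonneg hone).le_algebraMap_norm_self
      (norm_nonneg a)
  have hneg := ((φ.apply_le_of_isSelfAdjoint (-a) ha.neg).trans_eq (by rw [norm_neg])).trans hle
  rw [map_neg] at hneg
  refine norm_le_of_neg_le_of_le hφa (by positivity) ?_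
    ((φ.apply_le_of_isSelfAdjoint a ha).trans hle)
  rw [map_neg]
  exact neg_le.1 hneg

/-- The maps `φ t` are only assumed to be strongly continuous in `t`; joint continuity along a
continuous field follows because `‖φ t‖ ≤ ‖φ t 1‖` on self-adjoint elements. -/
theorem continuous_apply_of_isSelfAdjoint {φ : T → A →ₚ[ℂ] B}
    (hφ : ∀ a, Continuous fun t => φ t a) {a : T → A} (ha : Continuous a)
    (hsa : ∀ t, IsSelfAdjoint (a t)) : Continuous fun t => φ t (a t) := by
  refine continuous_iff_continuousAt.2 fun t₀ => ?_
  have h1 : Tendsto (fun t => φ t (a t - a t₀)) (𝓝 t₀) (𝓝 0) := by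
    refine squeeze_zero_norm (fun t =>
      (φ t).norm_apply_le_of_isSelfAdjoint ((hsa t).sub (hsa t₀))) ?_
    have h : Continuous fun t => ‖φ t 1‖ * ‖a t - a t₀‖ := by
      have := hφ 1
      fun_prop
    simpa using h.tendsto t₀
  have h2 := h1.add ((hφ (a t₀)).tendsto t₀)
  simpa [ContinuousAt] using h2

variable [MeasurableSpace T] [BorelSpace T]

/-- A continuous function vanishing where a continuous integrable function `h` vanishes is almost
everywhere strongly measurable, although neither the space nor the target need be separable:
`{h ≠ 0}` is a countable union of open sets of finite measure, each of which is exhausted by compact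
sets up to a null set, and images of compact sets are separable. -/
theorem Continuous.aestronglyMeasurable_of_support_subset [T2Space T] {μ : Measure T} [μ.Regular]
    {E : Type*} [NormedAddCommGroup E] {g h : T → E} (hg : Continuous g) (hh : Continuous h)
    (hint : Integrable h μ) (hgh : ∀ t, h t = 0 → g t = 0) : AEStronglyMeasurable g μ := by
  borelize E
  refine aestronglyMeasurable_iff_aemeasurable_separable.2 ⟨hg.measurable.aemeasurable, ?_⟩
  let O (n : ℕ) : Set T := {t | 1 / ((n : ℝ) + 1) < ‖h t‖}
  have hO (n : ℕ) : IsOpen (O n) := isOpen_lt continuous_const hh.norm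
  have hOμ (n : ℕ) : μ (O n) ≠ ⊤ := (hint.measure_norm_gt_lt_top Nat.one_div_pos_of_nat).ne
  have hK (n k : ℕ) : ∃ K ⊆ O n, IsCompact K ∧ μ (O n \ K) < ENNReal.ofReal (1 / ((k : ℝ) + 1)) :=
    (hO n).measurableSet.exists_isCompact_sdiff_lt (hOμ n)
      (ENNReal.ofReal_pos.2 Nat.one_div_pos_of_nat).ne'
  choose K hKO hKc hKμ using hK
  refine ⟨(⋃ n, ⋃ k, g '' K n k) ∪ {0}, ?_, ?_⟩
  · refine TopologicalSpace.IsSeparable.union ?_ (Set.finite_singleton _).isSeparable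
    exact .iUnion fun n => .iUnion fun k => ((hKc n k).image hg).isSeparable
  · have hnull (n : ℕ) : μ (O n \ ⋃ k, K n k) = 0 := by
      refine le_antisymm (ge_of_tendsto' (x := atTop)
        (f := fun k : ℕ => ENNReal.ofReal (1 / ((k : ℝ) + 1))) ?_ fun k => ?_) bot_le
      · simpa using ENNReal.tendsto_ofReal tendsto_one_div_add_atTop_nhds_zero_nat
      · exact (measure_mono (Set.sdiff_subset_sdiff_right (Set.subset_iUnion _ k))).trans (hKμ n k).le
    filter_upwards [ae_all_iff.2 fun n => measure_eq_zero_iff_ae_notMem.1 (hnull n)] with t ht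
    by_cases h0 : h t = 0
    · exact Or.inr (hgh t h0)
    · obtain ⟨n, hn⟩ := exists_nat_one_div_lt (norm_pos_iff.2 h0)
      have htK : t ∈ ⋃ k, K n k := by
        by_contra hc
        exact ht n ⟨hn, hc⟩
      obtain ⟨k, hk⟩ := Set.mem_iUnion.1 htK
      exact Or.inl (Set.mem_iUnion₂.2 ⟨n, k, t, hk, rfl⟩)

theorem IsUnitalField.integrable_apply [T2Space T] {μ : Measure T} [μ.Regular]
    {φ : T → A →ₚ[ℂ] B} (hφ : IsUnitalField μ φ) {a : T → A} (ha : Continuous a)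
    (hsa : ∀ t, IsSelfAdjoint (a t)) {C : ℝ} (hC : ∀ t, ‖a t‖ ≤ C) :
    Integrable (fun t => φ t (a t)) μ := by
  have hle (t : T) : ‖φ t (a t)‖ ≤ ‖φ t 1‖ * C :=
    ((φ t).norm_apply_le_of_isSelfAdjoint (hsa t)).trans
      (mul_le_mul_of_nonneg_left (hC t) (norm_nonneg _))
  refine (hφ.integrable_one.norm.mul_const C).mono' ?_ (ae_of_all μ hle)
  refine (continuous_apply_of_isSelfAdjoint hφ.continuous ha
    hsa).aestronglyMeasurable_of_support_subset (hφ.continuous 1) hφ.integrable_one fun t ht => ?_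
  simpa [ht] using hle t

theorem IsUnitalField.integrable_cfc [T2Space T] {μ : Measure T} [μ.Regular]
    {φ : T → A →ₚ[ℂ] B} (hφ : IsUnitalField μ φ) {m M : ℝ} {x : T → A} (hx : Continuous x)
    (hsa : ∀ t, IsSelfAdjoint (x t)) (hspec : ∀ t, spectrum ℝ (x t) ⊆ Set.Icc m M)
    {f : ℝ → ℝ} (hf : ContinuousOn f (Set.Icc m M)) :
    Integrable (fun t => φ t (cfc f (x t))) μ := by
  obtain ⟨C, hC⟩ := isCompact_Icc.exists_bound_of_continuousOn hf
  refine hφ.integrable_apply (C := max C 0) (hx.cfc' isCompact_Icc f hspec hf hsa)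
    (fun t => IsSelfAdjoint.cfc) fun t => ?_
  exact norm_cfc_le (le_max_right _ _) fun s hs => (hC s (hspec t hs)).trans (le_max_left _ _)

/-- The unital positive linear map `h ↦ ∫ φ_t(h(x_t)) dμ(t)` from `C([m, M], ℝ)` to `B`. -/
noncomputable def IsUnitalField.integralMap [T2Space T] {μ : Measure T} [μ.Regular]
    {φ : T → A →ₚ[ℂ] B} (hφ : IsUnitalField μ φ) {m M : ℝ} (hmM : m ≤ M) {x : T → A}
    (hx : Continuous x) (hsa : ∀ t, IsSelfAdjoint (x t))
    (hspec : ∀ t, spectrum ℝ (x t) ⊆ Set.Icc m M) : C(Set.Icc m M, ℝ) →ₗ[ℝ] B where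
  toFun h := ∫ t, φ t (cfc (Set.IccExtend hmM h) (x t)) ∂μ
  map_add' h k := by
    have hh (h : C(Set.Icc m M, ℝ)) : Continuous (Set.IccExtend hmM h) := h.continuous.Icc_extend'
    rw [← integral_add (hφ.integrable_cfc hx hsa hspec (hh h).continuousOn)
      (hφ.integrable_cfc hx hsa hspec (hh k).continuousOn)]
    refine integral_congr_ae (ae_of_all _ fun t => ?_)
    simp only
    rw [← map_add, ← cfc_add _ _ _ (hh h).continuousOn (hh k).continuousOn]
    rfl
  map_smul' r h := by
    have hh (h : C(Set.Icc m M, ℝ)) : Continuous (Set.IccExtend hmM h) := h.continuous.Icc_extend'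
    rw [RingHom.id_apply, ← integral_smul]
    refine integral_congr_ae (ae_of_all _ fun t => ?_)
    simp only
    rw [← (φ t).map_smul_of_tower, ← cfc_smul _ _ _ (hh h).continuousOn]
    rfl

section

variable [T2Space T] {μ : Measure T} [μ.Regular] {φ : T → A →ₚ[ℂ] B} (hφ : IsUnitalField μ φ)
  {m M : ℝ} (hmM : m ≤ M) {x : T → A} (hx : Continuous x) (hsa : ∀ t, IsSelfAdjoint (x t))
  (hspec : ∀ t, spectrum ℝ (x t) ⊆ Set.Icc m M)

theorem IsUnitalField.integralMap_restrictIcc {f : ℝ → ℝ} (hf : ContinuousOn f (Set.Icc m M)) :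
    hφ.integralMap hmM hx hsa hspec (restrictIcc hf) = ∫ t, φ t (cfc f (x t)) ∂μ := by
  refine integral_congr_ae (ae_of_all _ fun t => ?_)
  refine congrArg (φ t) (cfc_congr fun s hs => ?_)
  exact Set.IccExtend_of_mem hmM _ (hspec t hs)

theorem IsUnitalField.integralMap_coordIcc :
    hφ.integralMap hmM hx hsa hspec (coordIcc m M) = ∫ t, φ t (x t) ∂μ := by
  refine (hφ.integralMap_restrictIcc hmM hx hsa hspec (f := id) continuousOn_id).trans ?_
  simp only [cfc_id ℝ _ (hsa _)]

theorem IsUnitalField.integralMap_one : hφ.integralMap hmM hx hsa hspec 1 = 1 := by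
  refine (hφ.integralMap_restrictIcc hmM hx hsa hspec (f := fun _ => 1) continuousOn_const).trans ?_
  simp only [cfc_const_one ℝ _ (hsa _)]
  exact hφ.integral_one

theorem IsUnitalField.integralMap_nonneg {h : C(Set.Icc m M, ℝ)} (hh : 0 ≤ h) :
    0 ≤ hφ.integralMap hmM hx hsa hspec h :=
  integral_nonneg fun t => (φ t).map_nonneg (cfc_nonneg fun _ _ => hh _)

end

/-! ### Evaluation on commuting pairs and the final inequalities -/

/-- If the elements `Gₙ(z)` converge in norm and the functions `Gₙ` converge pointwise on the spectrum
of `z`, then the convergence on the spectrum is uniform, since the functional calculus is isometric. -/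
theorem continuousOn_and_eq_cfc_of_tendsto {D : Type*} [CStarAlgebra D] {z : D}
    (hz : IsSelfAdjoint z) {G : ℕ → ℝ → ℝ} {G' : ℝ → ℝ}
    (hG : ∀ n, ContinuousOn (G n) (spectrum ℝ z))
    (hlim : ∀ s ∈ spectrum ℝ z, Tendsto (fun n => G n s) atTop (𝓝 (G' s))) {d : D}
    (hd : Tendsto (fun n => cfc (G n) z) atTop (𝓝 d)) :
    ContinuousOn G' (spectrum ℝ z) ∧ d = cfc G' z := by
  have hcauchy : UniformCauchySeqOn G atTop (spectrum ℝ z) := by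
    refine Metric.uniformCauchySeqOn_iff.2 fun ε hε => ?_
    obtain ⟨N, hN⟩ := Metric.cauchySeq_iff.1 hd.cauchySeq ε hε
    refine ⟨N, fun m hm n hn s hs => lt_of_le_of_lt ?_ (hN m hm n hn)⟩
    rw [dist_eq_norm, dist_eq_norm, ← cfc_sub _ _ _ (hG m) (hG n)]
    exact norm_apply_le_norm_cfc (fun r => G m r - G n r) z hs ((hG m).sub (hG n))
  have hunif := hcauchy.tendstoUniformlyOn_of_tendsto hlim
  exact ⟨hunif.continuousOn (Frequently.of_forall hG),
    tendsto_nhds_unique hd (tendsto_cfc_fun hunif (Eventually.of_forall hG))⟩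

theorem AdmissiblePair.cfc {U V : Set ℝ} {f g : ℝ → ℝ} {D : Type u} [CStarAlgebra D] {z : D}
    (hz : IsSelfAdjoint z)
    (hf : ContinuousOn f (spectrum ℝ z)) (hg : ContinuousOn g (spectrum ℝ z))
    (hfU : f '' spectrum ℝ z ⊆ U) (hgV : g '' spectrum ℝ z ⊆ V) :
    AdmissiblePair U V (cfc f z) (cfc g z) :=
  ⟨IsSelfAdjoint.cfc, IsSelfAdjoint.cfc, by rwa [cfc_map_spectrum f z],
    by rwa [cfc_map_spectrum g z]⟩

/-- On a pair `f(z)`, `g(z)` of functions of one element, an operator map is the functional calculus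
of `s ↦ F (f s) (g s)`. Continuity of this function is part of the induction, as `F` itself need not
be continuous. -/
theorem IsOperatorVersion.apply_cfc {U V : Set ℝ} {F : ℝ → ℝ → ℝ} {Φ : OperatorMap.{u}}
    (hΦ : IsOperatorVersion U V F Φ) {f g : ℝ → ℝ} {D : Type u} [CStarAlgebra D] {z : D}
    (hz : IsSelfAdjoint z)
    (hf : ContinuousOn f (spectrum ℝ z)) (hg : ContinuousOn g (spectrum ℝ z))
    (hfU : f '' spectrum ℝ z ⊆ U) (hgV : g '' spectrum ℝ z ⊆ V) :
    ContinuousOn (fun s => F (f s) (g s)) (spectrum ℝ z) ∧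
      Φ D (cfc f z) (cfc g z) = cfc (fun s => F (f s) (g s)) z := by
  have hadm : AdmissiblePair U V (cfc f z) (cfc g z) := .cfc hz hf hg hfU hgV
  induction hΦ with
  | const r => exact ⟨continuousOn_const, (cfc_const r z).symm⟩
  | fst => exact ⟨hf, rfl⟩
  | snd => exact ⟨hg, rfl⟩
  | add F G Φ Ψ _ _ h1 h2 =>
    exact ⟨h1.1.add h2.1, by beta_reduce; rw [h1.2, h2.2, ← cfc_add _ _ _ h1.1 h2.1]⟩
  | mul F G Φ Ψ _ _ h1 h2 =>
    exact ⟨h1.1.mul h2.1, by beta_reduce; rw [h1.2, h2.2, ← cfc_mul _ _ _ h1.1 h2.1]⟩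
  | comp h F Φ _ hh ih =>
    have hc := (hh D _ _ hadm).2
    rw [ih.2, cfc_map_spectrum _ z hz ih.1] at hc
    exact ⟨hc.comp ih.1 (Set.mapsTo_image _ _), by beta_reduce; rw [ih.2, ← cfc_comp' _ _ z hc ih.1]⟩
  | lim Fn Φn F Φ _ hF hΦ ih =>
    refine continuousOn_and_eq_cfc_of_tendsto hz (fun n => (ih n).1) (fun s hs =>
      hF _ (hfU (Set.mem_image_of_mem f hs)) _ (hgV (Set.mem_image_of_mem g hs))) ?_
    exact (hΦ D _ _ hadm).congr fun n => (ih n).2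

/-- The image `f([m, M])` is a compact interval, so it suffices to integrate the two-sided bound. -/
theorem IsUnitalField.spectrum_integral_cfc_subset {T : Type w} [TopologicalSpace T] [T2Space T]
    [MeasurableSpace T] [BorelSpace T] {μ : Measure T} [μ.Regular]
    {A : Type v} [CStarAlgebra A] [PartialOrder A] [StarOrderedRing A]
    {B : Type u} [CStarAlgebra B] [PartialOrder B] [StarOrderedRing B]
    {φ : T → A →ₚ[ℂ] B} (hφ : IsUnitalField μ φ)
    {m M : ℝ} (hmM : m ≤ M) {x : T → A} (hx : Continuous x) (hsa : ∀ t, IsSelfAdjoint (x t))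
    (hspec : ∀ t, spectrum ℝ (x t) ⊆ Set.Icc m M)
    {f : ℝ → ℝ} (hf : ContinuousOn f (Set.Icc m M)) :
    IsSelfAdjoint (∫ t, φ t (cfc f (x t)) ∂μ) ∧
      spectrum ℝ (∫ t, φ t (cfc f (x t)) ∂μ) ⊆ f '' Set.Icc m M := by
  have hsaI : IsSelfAdjoint (∫ t, φ t (cfc f (x t)) ∂μ) := by
    refine ((starL' ℝ : B ≃L[ℝ] B).integral_comp_comm _).symm.trans ?_
    exact integral_congr_ae (ae_of_all _ fun t => IsSelfAdjoint.cfc.map (φ t))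
  refine ⟨hsaI, ?_⟩
  have himage := hf.image_Icc hmM
  have hmem {s : ℝ} (hs : s ∈ Set.Icc m M) := himage ▸ Set.mem_image_of_mem f hs
  have hint {h : ℝ → ℝ} (hh : ContinuousOn h (Set.Icc m M)) :=
    hφ.integrable_cfc hx hsa hspec hh
  have hconst (r : ℝ) : ∫ t, φ t (cfc (fun _ => r) (x t)) ∂μ = algebraMap ℝ B r := by
    simp only [cfc_const r _ (hsa _), Algebra.algebraMap_eq_smul_one,
      PositiveLinearMap.map_smul_of_tower, integral_smul, hφ.integral_one]
  rw [himage, spectrum_subset_Icc_iff hsaI, ← hconst, ← hconst]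
  refine ⟨integral_mono (hint continuousOn_const) (hint hf) fun t => ?_,
    integral_mono (hint hf) (hint continuousOn_const) fun t => ?_⟩
  · exact OrderHomClass.mono (φ t) (cfc_mono (fun s hs => (hmem (hspec t hs)).1)
      continuousOn_const (hf.mono (hspec t)))
  · exact OrderHomClass.mono (φ t) (cfc_mono (fun s hs => (hmem (hspec t hs)).2)
      (hf.mono (hspec t)) continuousOn_const)

/-- Jensen's operator inequality for a unital field of positive linear maps. -/
theorem OperatorConvexOn.cfc_integral_le {T : Type w} [TopologicalSpace T] [T2Space T]
    [MeasurableSpace T] [BorelSpace T] {μ : Measure T} [μ.Regular]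
    {A : Type v} [CStarAlgebra A] [PartialOrder A] [StarOrderedRing A]
    {B : Type u} [CStarAlgebra B] [PartialOrder B] [StarOrderedRing B]
    {φ : T → A →ₚ[ℂ] B} (hφ : IsUnitalField μ φ)
    {m M : ℝ} (hmM : m ≤ M) {x : T → A} (hx : Continuous x) (hsa : ∀ t, IsSelfAdjoint (x t))
    (hspec : ∀ t, spectrum ℝ (x t) ⊆ Set.Icc m M)
    {f : ℝ → ℝ} (hf : OperatorConvexOn.{u} (Set.Icc m M) f) :
    cfc f (∫ t, φ t (x t) ∂μ) ≤ ∫ t, φ t (cfc f (x t)) ∂μ := by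
  have h := hf.map_coordIcc_le hmM (hφ.integralMap hmM hx hsa hspec)
    (fun h hh => hφ.integralMap_nonneg hmM hx hsa hspec hh)
    (hφ.integralMap_one hmM hx hsa hspec)
  rwa [hφ.integralMap_coordIcc, hφ.integralMap_restrictIcc] at h

theorem theorem3p4
    {T : Type w} [TopologicalSpace T] [LocallyCompactSpace T] [T2Space T]
    [MeasurableSpace T] [BorelSpace T] (μ : Measure T) [μ.Regular]
    {A : Type v} [CStarAlgebra A] [PartialOrder A] [StarOrderedRing A]
    {B : Type u} [CStarAlgebra B] [PartialOrder B] [StarOrderedRing B]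
    (m M : ℝ) (hmM : m ≤ M)
    (x : T →ᵇ A) (hx : ∀ t, IsSelfAdjoint (x t)) (hspec : ∀ t, spectrum ℝ (x t) ⊆ Set.Icc m M)
    (φ : T → A →ₚ[ℂ] B) (hφ : IsUnitalField μ φ)
    (f g : ℝ → ℝ) (hf : ContinuousOn f (Set.Icc m M)) (hg : ContinuousOn g (Set.Icc m M))
    (U V : Set ℝ) (hfU : f '' Set.Icc m M ⊆ U) (hgV : g '' Set.Icc m M ⊆ V)
    (F : ℝ → ℝ → ℝ) (hF : ∃ C : ℝ, ∀ t ∈ U, ∀ s ∈ V, |F t s| ≤ C)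
    (Φ : OperatorMap.{u}) (hΦ : IsOperatorVersion U V F Φ) (hmono : OperatorMonotoneFst U V Φ) :
    -- the integrals exist, and `F[⬝, ⬝]` is evaluated at an admissible pair
    (Integrable (fun t => φ t (x t)) μ ∧
      Integrable (fun t => φ t (cfc f (x t))) μ ∧
      IsSelfAdjoint (∫ t, φ t (x t) ∂μ) ∧
      spectrum ℝ (∫ t, φ t (x t) ∂μ) ⊆ Set.Icc m M ∧
      AdmissiblePair U V (∫ t, φ t (cfc f (x t)) ∂μ) (cfc g (∫ t, φ t (x t) ∂μ))) ∧
    (OperatorConvexOn.{u} (Set.Icc m M) f →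
      algebraMap ℝ B (⨅ z : Set.Icc m M, F (f z) (g z)) ≤
        Φ B (∫ t, φ t (cfc f (x t)) ∂μ) (cfc g (∫ t, φ t (x t) ∂μ))) ∧
    (OperatorConcaveOn.{u} (Set.Icc m M) f →
      Φ B (∫ t, φ t (cfc f (x t)) ∂μ) (cfc g (∫ t, φ t (x t) ∂μ)) ≤
        algebraMap ℝ B (⨆ z : Set.Icc m M, F (f z) (g z))) := by
  set z : B := ∫ t, φ t (x t) ∂μ with hzdef
  set y : B := ∫ t, φ t (cfc f (x t)) ∂μ with hydef
  have hxc : Continuous fun t => x t := x.continuous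
  obtain ⟨hz, hzI⟩ : IsSelfAdjoint z ∧ spectrum ℝ z ⊆ Set.Icc m M := by
    have h := hφ.spectrum_integral_cfc_subset hmM hxc hx hspec (f := id) continuousOn_id
    simpa only [cfc_id ℝ _ (hx _), Set.image_id] using h
  obtain ⟨hy, hyI⟩ := hφ.spectrum_integral_cfc_subset hmM hxc hx hspec hf
  have hzint : Integrable (fun t => φ t (x t)) μ := by
    have h := hφ.integrable_cfc hxc hx hspec (f := id) continuousOn_id
    simpa only [cfc_id ℝ _ (hx _)] using h
  have hfz := hf.mono hzI
  have hgz := hg.mono hzI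
  have hfzU := (Set.image_mono hzI).trans hfU
  have hgzV := (Set.image_mono hzI).trans hgV
  have hadm : AdmissiblePair U V (cfc f z) (cfc g z) := .cfc hz hfz hgz hfzU hgzV
  have hadm' : AdmissiblePair U V y (cfc g z) := ⟨hy, hadm.2.1, hyI.trans hfU, hadm.2.2.2⟩
  obtain ⟨hcont, heq⟩ := hΦ.apply_cfc hz hfz hgz hfzU hgzV
  obtain ⟨C, hC⟩ := hF
  have hbdd (s : Set.Icc m M) : |F (f s) (g s)| ≤ C :=
    hC _ (hfU (Set.mem_image_of_mem f s.2)) _ (hgV (Set.mem_image_of_mem g s.2))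
  refine ⟨⟨hzint, hφ.integrable_cfc hxc hx hspec hf, hz, hzI, hadm'⟩, fun hconv => ?_,
    fun hconc => ?_⟩
  · have hle : cfc f z ≤ y := hconv.cfc_integral_le hφ hmM hxc hx hspec
    refine le_trans ?_ (hmono.apply_le hΦ hadm hadm' hle)
    rw [heq]
    refine algebraMap_le_cfc _ _ z (fun s hs => ?_) hcont hz
    have hbelow : BddBelow (Set.range fun s : Set.Icc m M => F (f s) (g s)) :=
      ⟨-C, Set.forall_mem_range.2 fun s => (abs_le.1 (hbdd s)).1⟩
    exact ciInf_le hbelow ⟨s, hzI hs⟩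
  · have hle : y ≤ cfc f z := by
      have h := OperatorConvexOn.cfc_integral_le hφ hmM hxc hx hspec hconc
      simpa only [cfc_neg, map_neg, integral_neg, neg_le_neg_iff] using h
    refine (hmono.apply_le hΦ hadm' hadm hle).trans ?_
    rw [heq]
    refine cfc_le_algebraMap _ _ z (fun s hs => ?_) hcont hz
    have habove : BddAbove (Set.range fun s : Set.Icc m M => F (f s) (g s)) :=
      ⟨C, Set.forall_mem_range.2 fun s => (abs_le.1 (hbdd s)).2⟩
    exact le_ciSup habove ⟨s, hzI hs⟩
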